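/- Let $M$ be a smooth manifold of dimension $n\ge 2$. A (strongly convex) Randers metric on $M$ is a function $F(x,y)=\sqrt{g_x(y,y)}+b_x(y)$, $x\in M$, $y\in T_xM$, where $g$ is a smooth Riemannian metric and $b$ a smooth $1$-form with $\|b\|^2=g^{ij}b_ib_j<1$. It is called Riemannian if $F(x,y)=\sqrt{h_x(y,y)}$ for some smooth Riemannian metric $h$ on $M$, and of Berwald type if, in all local coordinates, the coefficients $\Gamma^i_{jk}(x,y)$ of its Chern connection do not depend on $y\neq 0$. Put $\beta=b^i(b_{j|i}-b_{i|j})\,dx^j$, where $b^i=g^{ik}b_k$ and the bar denotes the covariant derivative for the Levi-Civita connection of $g$. For linearly independent $y,v\in T_xM$, the flag curvature of the flag $(\operatorname{span}\{y,v\},y)$ is $$K(y,v)=\frac{g_y(R(v,y)y,v)}{g_y(y,y)\,g_y(v,v)-g_y(y,v)^2},$$ where $g_y(u,w)=\tfrac12\frac{\partial^2}{\partial s\,\partial t}F^2(x,y+su+tw)|_{s=t=0}$ and $R$ is the (horizontal) curvature tensor of the Chern connection of $F$ at $(x,y)$. Then there is no Randers metric on $M$ that is not Riemannian, is of Berwald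 type, satisfies $\beta=0$, and has constant positive flag curvature (that is, for which there is a constant $K>0$ such that every flag at every point of $M$ has flag curvature $K$). -/

import Mathlib

open scoped Manifold ContDiff Bundle

noncomputable section

/-! ### Finsler geometry in local coordinates

Throughout, `L u y` is a function of the coordinates `u` of a point and of the components `y` of a
tangent vector at that point: the local expression of a Finsler function. All the tensors below
are meant at `y ≠ 0`. -/

/-- Coordinate space `ℝⁿ`. -/
abbrev Coord (n : ℕ) : Type := EuclideanSpace ℝ (Fin n)

/-- The `i`-th standard basis vector of `ℝⁿ`. -/
abbrev coordVec {n : ℕ} (i : Fin n) : Coord n := EuclideanSpace.single i (1 : ℝ)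

namespace Finsler

variable {n : ℕ}

/-- The partial derivative `∂f/∂xᵏ`. -/
def pdx (f : Coord n → Coord n → ℝ) (k : Fin n) (u y : Coord n) : ℝ :=
  fderiv ℝ (fun u' : Coord n => f u' y) u (coordVec k)

/-- The partial derivative `∂f/∂yᵏ`. -/
def pdy (f : Coord n → Coord n → ℝ) (k : Fin n) (u y : Coord n) : ℝ :=
  fderiv ℝ (fun y' : Coord n => f u y') y (coordVec k)

/-- The fundamental tensor `g_ij = ½ ∂²(L²)/∂yⁱ∂yʲ`. -/
def fundTensor (L : Coord n → Coord n → ℝ) (i j : Fin n) (u y : Coord n) : ℝ :=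
  (1 / 2) * pdy (pdy (fun u' y' => L u' y' ^ 2) j) i u y

/-- The inverse matrix `gⁱʲ` of the fundamental tensor. -/
def fundInv (L : Coord n → Coord n → ℝ) (i j : Fin n) (u y : Coord n) : ℝ :=
  (Matrix.of fun a b => fundTensor L a b u y)⁻¹ i j

/-- The Cartan tensor `C_ijk = ½ ∂g_ij/∂yᵏ`. -/
def cartan (L : Coord n → Coord n → ℝ) (i j k : Fin n) (u y : Coord n) : ℝ :=
  (1 / 2) * pdy (fundTensor L i j) k u y

/-- The formal Christoffel symbols
`γⁱ_jk = ½ gⁱˢ (∂g_sj/∂xᵏ - ∂g_jk/∂xˢ + ∂g_ks/∂xʲ)`. -/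
def formalChristoffel (L : Coord n → Coord n → ℝ) (i j k : Fin n) (u y : Coord n) : ℝ :=
  ∑ s, fundInv L i s u y / 2 *
    (pdx (fundTensor L s j) k u y - pdx (fundTensor L j k) s u y + pdx (fundTensor L k s) j u y)

/-- The nonlinear connection `Nⁱ_j = γⁱ_jk yᵏ - Cⁱ_jk γᵏ_rs yʳ yˢ`. -/
def nonlinearConnection (L : Coord n → Coord n → ℝ) (i j : Fin n) (u y : Coord n) : ℝ :=
  ∑ k, formalChristoffel L i j k u y * y k -
    ∑ k, (∑ l, fundInv L i l u y * cartan L l j k u y) *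
      ∑ r, ∑ s, formalChristoffel L k r s u y * y r * y s

/-- The horizontal derivative `δf/δxᵏ = ∂f/∂xᵏ - Nᵐ_k ∂f/∂yᵐ`. -/
def horizDeriv (L f : Coord n → Coord n → ℝ) (k : Fin n) (u y : Coord n) : ℝ :=
  pdx f k u y - ∑ m, nonlinearConnection L m k u y * pdy f m u y

/-- The coefficients of the Chern connection,
`Γⁱ_jk = ½ gⁱˢ (δg_sj/δxᵏ - δg_jk/δxˢ + δg_ks/δxʲ)`. -/
def chern (L : Coord n → Coord n → ℝ) (i j k : Fin n) (u y : Coord n) : ℝ :=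
  ∑ s, fundInv L i s u y / 2 *
    (horizDeriv L (fundTensor L s j) k u y - horizDeriv L (fundTensor L j k) s u y +
      horizDeriv L (fundTensor L k s) j u y)

/-- The (hh-)curvature tensor of the Chern connection,
`R_jⁱ_kl = δΓⁱ_jl/δxᵏ - δΓⁱ_jk/δxˡ + Γⁱ_hk Γʰ_jl - Γⁱ_hl Γʰ_jk`. -/
def chernCurvature (L : Coord n → Coord n → ℝ) (j i k l : Fin n) (u y : Coord n) : ℝ :=
  horizDeriv L (chern L i j l) k u y - horizDeriv L (chern L i j k) l u y +
    ∑ h, (chern L i h k u y * chern L h j l u y - chern L i h l u y * chern L h j k u y)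

/-- The inner product `g_y(v, w)` given by the fundamental tensor. -/
def fundInner (L : Coord n → Coord n → ℝ) (u y v w : Coord n) : ℝ :=
  ∑ i, ∑ j, fundTensor L i j u y * v i * w j

/-- The vector `R(v, y) y`, with components `yʲ R_jⁱ_kl vᵏ yˡ`. -/
def curvatureVec (L : Coord n → Coord n → ℝ) (u y v : Coord n) : Coord n :=
  WithLp.toLp 2 fun i => ∑ j, ∑ k, ∑ l, y j * chernCurvature L j i k l u y * v k * y l

/-- The flag curvature, in local coordinates, of the flag with flagpole `y` and transverse edge
`v`: `g_y(R(v, y) y, v) / (g_y(y, y) g_y(v, v) - g_y(y, v)²)`. -/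
def localFlagCurvature (L : Coord n → Coord n → ℝ) (u y v : Coord n) : ℝ :=
  fundInner L u y (curvatureVec L u y v) v /
    (fundInner L u y y y * fundInner L u y v v - fundInner L u y y v ^ 2)

end Finsler

/-! ### Finsler functions on manifolds -/

section Manifold

variable {n : ℕ} {M : Type*} [TopologicalSpace M] [ChartedSpace (Coord n) M]

/-- The tangent vector at the point with coordinates `u` whose components in the chart `φ`
are `y`. -/
def chartVec (φ : OpenPartialHomeomorph M (Coord n)) (u y : Coord n) :
    TangentSpace (𝓡 n) (φ.symm u) :=
  mfderiv (𝓡 n) (𝓡 n) φ.symm u y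

/-- The components in the preferred chart at `x` of a tangent vector at `x`. -/
def components (x : M) (v : TangentSpace (𝓡 n) x) : Coord n :=
  mfderiv (𝓡 n) (𝓡 n) (chartAt (Coord n) x) x v

/-- The local expression of a function on the tangent bundle in the chart `φ`. -/
def localExpr (F : ∀ x : M, TangentSpace (𝓡 n) x → ℝ)
    (φ : OpenPartialHomeomorph M (Coord n)) (u y : Coord n) : ℝ :=
  F (φ.symm u) (chartVec φ u y)

/-- The flag curvature at `x` of the flag `(span {y, v}, y)`. -/
def flagCurvature (F : ∀ x : M, TangentSpace (𝓡 n) x → ℝ) (x : M)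
    (y v : TangentSpace (𝓡 n) x) : ℝ :=
  Finsler.localFlagCurvature (localExpr F (chartAt (Coord n) x)) (chartAt (Coord n) x x)
    (components x y) (components x v)

/-- `F` has constant flag curvature `K`. -/
def HasConstantFlagCurvature (F : ∀ x : M, TangentSpace (𝓡 n) x → ℝ) (K : ℝ) : Prop :=
  ∀ (x : M) (y v : TangentSpace (𝓡 n) x), LinearIndependent ℝ ![y, v] →
    flagCurvature F x y v = K

/-- `F` is of Berwald type: in all local coordinates, the coefficients of the Chern connection do
not depend on the direction. -/
def IsBerwald (F : ∀ x : M, TangentSpace (𝓡 n) x → ℝ) : Prop :=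
  ∀ φ ∈ IsManifold.maximalAtlas (𝓡 n) ∞ M, ∀ u ∈ φ.target, ∀ y z : Coord n, y ≠ 0 → z ≠ 0 →
    ∀ i j k, Finsler.chern (localExpr F φ) i j k u y = Finsler.chern (localExpr F φ) i j k u z

variable [IsManifold (𝓡 n) ∞ M]

variable (n M) in
/-- Smooth Riemannian metrics on `M`. -/
abbrev RiemMetric : Type _ :=
  Bundle.ContMDiffRiemannianMetric (𝓡 n) ∞ (Coord n) (fun x : M => TangentSpace (𝓡 n) x)

/-- `F` is the norm of a smooth Riemannian metric. -/
def IsRiemannian (F : ∀ x : M, TangentSpace (𝓡 n) x → ℝ) : Prop :=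
  ∃ h : RiemMetric n M, ∀ (x : M) (y : TangentSpace (𝓡 n) x), F x y = √(h.inner x y y)

/-! ### Riemannian metrics and 1-forms in local coordinates -/

namespace RiemMetric

/-- The components `g_ij` in the chart `φ`. -/
def comp (g : RiemMetric n M) (φ : OpenPartialHomeomorph M (Coord n)) (i j : Fin n)
    (u : Coord n) : ℝ :=
  g.inner (φ.symm u) (chartVec φ u (coordVec i)) (chartVec φ u (coordVec j))

/-- The inverse matrix `gⁱʲ` in the chart `φ`. -/
def invComp (g : RiemMetric n M) (φ : OpenPartialHomeomorph M (Coord n)) (i j : Fin n)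
    (u : Coord n) : ℝ :=
  (Matrix.of fun a b => comp g φ a b u)⁻¹ i j

/-- The Christoffel symbols `½ gᵏˡ (∂_i g_lj + ∂_j g_il - ∂_l g_ij)` of the Levi-Civita
connection. -/
def christoffel (g : RiemMetric n M) (φ : OpenPartialHomeomorph M (Coord n)) (k i j : Fin n)
    (u : Coord n) : ℝ :=
  ∑ l, invComp g φ k l u / 2 *
    (fderiv ℝ (comp g φ l j) u (coordVec i) + fderiv ℝ (comp g φ i l) u (coordVec j) -
      fderiv ℝ (comp g φ i j) u (coordVec l))

end RiemMetric

/-- The components `b_i` of a 1-form in the chart `φ`. -/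
def formComp (b : ∀ x : M, TangentSpace (𝓡 n) x →L[ℝ] ℝ)
    (φ : OpenPartialHomeomorph M (Coord n)) (i : Fin n) (u : Coord n) : ℝ :=
  b (φ.symm u) (chartVec φ u (coordVec i))

/-- The components `b_{i|j}` of the covariant derivative of `b` for the Levi-Civita connection
of `g`. -/
def covDerivComp (g : RiemMetric n M) (b : ∀ x : M, TangentSpace (𝓡 n) x →L[ℝ] ℝ)
    (φ : OpenPartialHomeomorph M (Coord n)) (i j : Fin n) (u : Coord n) : ℝ :=
  fderiv ℝ (formComp b φ i) u (coordVec j) -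
    ∑ k, RiemMetric.christoffel g φ k i j u * formComp b φ k u

/-- `‖b‖² = gⁱʲ b_i b_j` at the point `x`. -/
def formNormSq (g : RiemMetric n M) (b : ∀ x : M, TangentSpace (𝓡 n) x →L[ℝ] ℝ) (x : M) : ℝ :=
  ∑ i, ∑ j, RiemMetric.invComp g (chartAt (Coord n) x) i j (chartAt (Coord n) x x) *
    formComp b (chartAt (Coord n) x) i (chartAt (Coord n) x x) *
    formComp b (chartAt (Coord n) x) j (chartAt (Coord n) x x)

/-- The components `bⁱ (b_{j|i} - b_{i|j})`, where `bⁱ = gⁱᵏ b_k`. -/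
def betaComp (g : RiemMetric n M) (b : ∀ x : M, TangentSpace (𝓡 n) x →L[ℝ] ℝ)
    (φ : OpenPartialHomeomorph M (Coord n)) (j : Fin n) (u : Coord n) : ℝ :=
  ∑ i, (∑ k, RiemMetric.invComp g φ i k u * formComp b φ k u) *
    (covDerivComp g b φ j i u - covDerivComp g b φ i j u)

/-! ### Randers metrics -/

variable (n M) in
/-- The data of a Randers metric: a smooth Riemannian metric `g` and a smooth 1-form `b` with
`‖b‖ < 1`. -/
structure RandersMetric where
  /-- The underlying Riemannian metric. -/
  g : RiemMetric n M
  /-- The drift 1-form. -/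
  b : ∀ x : M, TangentSpace (𝓡 n) x →L[ℝ] ℝ
  contMDiff_b : ContMDiff (𝓡 n) ((𝓡 n).prod 𝓘(ℝ, Coord n →L[ℝ] ℝ)) ∞
    (fun x : M => Bundle.TotalSpace.mk' (Coord n →L[ℝ] ℝ)
      (E := fun x : M => TangentSpace (𝓡 n) x →L[ℝ] Bundle.Trivial M ℝ x) x (b x))
  norm_lt_one : ∀ x : M, formNormSq g b x < 1

namespace RandersMetric

/-- The Finsler function `F(x, y) = √(g_x(y, y)) + b_x(y)`. -/
def F (R : RandersMetric n M) (x : M) (y : TangentSpace (𝓡 n) x) : ℝ :=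
  √(R.g.inner x y y) + R.b x y

/-- The 1-form `β = bⁱ (b_{j|i} - b_{i|j}) dxʲ`. -/
def beta (R : RandersMetric n M) (x : M) (v : TangentSpace (𝓡 n) x) : ℝ :=
  ∑ j, betaComp R.g R.b (chartAt (Coord n) x) j (chartAt (Coord n) x x) * components x v j

end RandersMetric

end Manifold

end

/-!
A Randers metric of Berwald type has a Chern connection whose coefficients depend only on the
point, hence so does its curvature tensor `R_jⁱ_kl`. The Ricci curvature
`Ric(y) = yʲ R_jⁱ_il yˡ`, the trace of `v ↦ R(v, y) y`, is then a quadratic form in `y`, and in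
particular `Ric(-y) = Ric(y)`.

If every flag with flagpole `y` has curvature `K`, then
`g_y(R(v, y) y, v) = K (F(y)² g_y(v, v) - g_y(y, v)²)` for all `v`; for `v` parallel to `y` both
sides vanish by the antisymmetry of the curvature. Taking the trace with respect to `g_y`, which
is positive definite because `‖b‖ < 1`, gives `Ric(y) = K (n - 1) F(y)²`
(`Finsler.trace_flagMatrix_of_localFlagCurvature_eq`).

As `K (n - 1) ≠ 0`, it follows that `F(-y)² = F(y)²`. For `F = α + β` with `β` linear this says
`4 α(y) β(y) = 0`, so the 1-form vanishes at every point
(`Finsler.eq_zero_of_localFlagCurvature_eq`) and `F` is the norm of a Riemannian metric.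
-/

/-! ### The trace of an operator with prescribed quadratic form -/

section Trace

open Matrix

/-- If `G` is symmetric and invertible and the quadratic form of `G T` is
`v ↦ K (G(y, y) G(v, v) - G(y, v)²)`, then taking the `G`-trace gives
`tr T = K (n - 1) G(y, y)`. No symmetry of `G T` is needed, because an operator and its
`G`-adjoint have the same trace. -/
theorem trace_eq_of_dotProduct_mulVec_eq {ι : Type*} [Fintype ι] [DecidableEq ι]
    {G T : Matrix ι ι ℝ} (hG : G.IsSymm) (hdet : IsUnit G.det) {K : ℝ} {y : ι → ℝ}
    (h : ∀ v, v ⬝ᵥ (G * T) *ᵥ v = K * ((y ⬝ᵥ G *ᵥ y) * (v ⬝ᵥ G *ᵥ v) - (y ⬝ᵥ G *ᵥ v) ^ 2)) :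
    T.trace = K * (Fintype.card ι - 1) * (y ⬝ᵥ G *ᵥ y) := by
  set q := y ⬝ᵥ G *ᵥ y
  set p := G *ᵥ y with hp
  have hyv : ∀ v, y ⬝ᵥ G *ᵥ v = p ⬝ᵥ v := fun v => by
    rw [dotProduct_mulVec, ← mulVec_transpose, hG.eq]
  have key : G * T + Tᵀ * G = (2 * K) • (q • G - vecMulVec p p) := by
    -- The quadratic form of the difference `D` vanishes and `D` is symmetric, so `D = 0`.
    rw [← sub_eq_zero]
    set D := G * T + Tᵀ * G - (2 * K) • (q • G - vecMulVec p p) with hD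
    have hDs : Dᵀ = D := by
      simp only [hD, transpose_sub, transpose_add, transpose_mul, transpose_smul, hG.eq,
        transpose_transpose, transpose_vecMulVec]
      rw [add_comm]
    have hDq : ∀ v, v ⬝ᵥ D *ᵥ v = 0 := fun v => by
      have h2 : v ⬝ᵥ (Tᵀ * G) *ᵥ v = v ⬝ᵥ (G * T) *ᵥ v := by
        rw [dotProduct_mulVec, ← mulVec_transpose, transpose_mul, transpose_transpose, hG.eq,
          dotProduct_comm]
      have h3 : v ⬝ᵥ vecMulVec p p *ᵥ v = (p ⬝ᵥ v) ^ 2 := by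
        rw [vecMulVec_mulVec, op_smul_eq_smul, dotProduct_smul, dotProduct_comm v p, smul_eq_mul]
        ring
      simp only [hD, sub_mulVec, add_mulVec, smul_mulVec, dotProduct_sub, dotProduct_add,
        dotProduct_smul, smul_eq_mul, h2, h3, h v, hyv v]
      ring
    ext i j
    have e1 := hDq (Pi.single i 1 + Pi.single j 1)
    have e2 := hDq (Pi.single i 1)
    have e3 := hDq (Pi.single j 1)
    have e4 : D j i = D i j := congrFun (congrFun hDs i) j
    simp only [mulVec_add, dotProduct_add, add_dotProduct, mulVec_single_one,
      single_one_dotProduct, col_apply] at e1 e2 e3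
    simp only [Matrix.zero_apply]
    linarith
  have htr := congrArg (fun A => trace (G⁻¹ * A)) key
  have t2 : trace (G⁻¹ * (Tᵀ * G)) = trace T := by
    rw [trace_mul_comm, Matrix.mul_assoc, mul_nonsing_inv _ hdet, Matrix.mul_one, trace_transpose]
  have t3 : trace (G⁻¹ * vecMulVec p p) = q := by
    rw [mul_vecMulVec, hp, mulVec_mulVec, nonsing_inv_mul _ hdet, one_mulVec, trace_vecMulVec]
  simp only [Matrix.mul_add, trace_add, Matrix.mul_smul, trace_smul, Matrix.mul_sub, trace_sub,
    nonsing_inv_mul _ hdet, trace_one, t3, ← Matrix.mul_assoc, Matrix.one_mul,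
    smul_eq_mul] at htr
  rw [Matrix.mul_assoc, t2] at htr
  linarith

end Trace

/-! ### The fundamental tensor of a Randers norm -/

section RandersNorm

variable {E : Type*} [AddCommGroup E] [Module ℝ E]

/-- The Randers norm `α + β` of a bilinear form `a` and a linear form `β`, where
`α(y) = √(a(y, y))`. -/
noncomputable def randersNorm (a : LinearMap.BilinForm ℝ E) (β : E →ₗ[ℝ] ℝ) (y : E) : ℝ :=
  √(a y y) + β y

/-- The fundamental form of the Randers norm `α + β` at `y`: with `ℓ = a(y, ·) / α(y)` it is
`(F(y) / α(y)) (a - ℓ ⊗ ℓ) + (ℓ + β) ⊗ (ℓ + β)`. -/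
noncomputable def randersForm (a : LinearMap.BilinForm ℝ E) (β : E →ₗ[ℝ] ℝ) (y : E) :
    LinearMap.BilinForm ℝ E :=
  LinearMap.mk₂ ℝ
    (fun v w => randersNorm a β y / √(a y y) *
        (a v w - a y v / √(a y y) * (a y w / √(a y y))) +
      (a y v / √(a y y) + β v) * (a y w / √(a y y) + β w))
    (fun v v' w => by simp only [map_add, LinearMap.add_apply]; ring)
    (fun c v w => by simp only [map_smul, LinearMap.smul_apply, smul_eq_mul]; ring)
    (fun v w w' => by simp only [map_add]; ring)
    (fun c v w => by simp only [map_smul, smul_eq_mul]; ring)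

variable {a : LinearMap.BilinForm ℝ E} {β : E →ₗ[ℝ] ℝ} {y : E}

theorem randersForm_apply (v w : E) :
    randersForm a β y v w =
      randersNorm a β y / √(a y y) * (a v w - a y v / √(a y y) * (a y w / √(a y y))) +
        (a y v / √(a y y) + β v) * (a y w / √(a y y) + β w) :=
  rfl

theorem randersForm_comm (ha : ∀ v w, a v w = a w v) (v w : E) :
    randersForm a β y v w = randersForm a β y w v := by
  rw [randersForm_apply, randersForm_apply, ha v w]
  ring

theorem randersForm_self (hy : 0 < a y y) :
    randersForm a β y y y = randersNorm a β y ^ 2 := by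
  have hs : √(a y y) ≠ 0 := (Real.sqrt_pos.2 hy).ne'
  have h1 : a y y / √(a y y) = √(a y y) := Real.div_sqrt
  rw [randersForm_apply, h1, Real.mul_self_sqrt hy.le, randersNorm]
  ring

/-- Strong convexity: the fundamental form is positive definite wherever the norm is positive. -/
theorem randersForm_pos (ha : ∀ v w, a v w = a w v) (hpos : ∀ v, v ≠ 0 → 0 < a v v)
    (hy : y ≠ 0) (hF : 0 < randersNorm a β y) {v : E} (hv : v ≠ 0) :
    0 < randersForm a β y v v := by
  have hyy := hpos y hy
  have hs : 0 < √(a y y) := Real.sqrt_pos.2 hyy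
  by_cases hli : LinearIndependent ℝ ![y, v]
  · have hcs := (LinearMap.BilinForm.apply_sq_lt_iff_linearIndependent_of_symm a hpos
      ⟨fun x z => ha x z⟩ y v).2 hli
    have h1 : 0 < a v v - a y v / √(a y y) * (a y v / √(a y y)) := by
      rw [div_mul_div_comm, Real.mul_self_sqrt hyy.le, sub_pos, div_lt_iff₀ hyy]
      nlinarith
    rw [randersForm_apply]
    have := mul_pos (div_pos hF hs) h1
    nlinarith [mul_self_nonneg (a y v / √(a y y) + β v)]
  · obtain ⟨c, rfl⟩ : ∃ c : ℝ, v = c • y := by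
      rw [LinearIndependent.pair_iff' hy] at hli
      push Not at hli
      exact hli.imp fun c hc => hc.symm
    have hc : c ≠ 0 := fun h => hv (by rw [h, zero_smul])
    have : randersForm a β y (c • y) (c • y) = c ^ 2 * randersForm a β y y y := by
      simp only [map_smul, LinearMap.smul_apply, smul_eq_mul]
      ring
    rw [this, randersForm_self hyy]
    positivity

/-- Cauchy–Schwarz: `α + β` is positive if `β` is the `a`-dual of a vector `w` of length less
than one. -/
theorem randersNorm_pos (ha : ∀ v w, a v w = a w v) (hpos : ∀ v, v ≠ 0 → 0 < a v v)
    {w : E} (hw : ∀ v, β v = a w v) (hw1 : a w w < 1) (hy : y ≠ 0) :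
    0 < randersNorm a β y := by
  have hyy := hpos y hy
  have hcs := LinearMap.BilinForm.apply_sq_le_of_symm a
    (fun x => by rcases eq_or_ne x 0 with rfl | h <;> simp [le_of_lt, *])
    ⟨fun x z => ha x z⟩ w y
  rw [← hw] at hcs
  have : |β y| < √(a y y) := by
    rw [← Real.sqrt_sq_eq_abs]
    exact Real.sqrt_lt_sqrt (sq_nonneg _) (hcs.trans_lt (by nlinarith))
  rw [randersNorm]
  linarith [neg_abs_le (β y)]

/-- The values of `(α + β)²` at `y` and `-y` differ by `4 α β`. -/
theorem eq_zero_of_randersNorm_sq_neg (hyy : 0 < a y y)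
    (h : randersNorm a β (-y) ^ 2 = randersNorm a β y ^ 2) : β y = 0 := by
  have hs : 0 < √(a y y) := Real.sqrt_pos.2 hyy
  simp only [randersNorm, map_neg, LinearMap.neg_apply, neg_neg] at h
  have : √(a y y) * β y = 0 := by linarith
  exact (mul_eq_zero.1 this).resolve_left hs.ne'

end RandersNorm

section RandersNormDeriv

variable {E : Type*} [NormedAddCommGroup E] [NormedSpace ℝ E] [FiniteDimensional ℝ E]
  {a : LinearMap.BilinForm ℝ E} {β : E →ₗ[ℝ] ℝ} {y : E}

theorem hasFDerivAt_sqrt_bilin (ha : ∀ v w, a v w = a w v) (hy : 0 < a y y) :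
    HasFDerivAt (fun z => √(a z z))
      ((√(a y y))⁻¹ • LinearMap.toContinuousLinearMap (a y)) y := by
  have h1 := (a.toContinuousBilinearMap.hasFDerivAt_of_bilinear (hasFDerivAt_id y)
    (hasFDerivAt_id y)).sqrt hy.ne'
  refine h1.congr_fderiv ?_
  ext v
  have hs : √(a y y) ≠ 0 := (Real.sqrt_pos.2 hy).ne'
  simp [ha v y]
  field_simp
  ring

theorem hasFDerivAt_randersNorm_sq (ha : ∀ v w, a v w = a w v) (hy : 0 < a y y) :
    HasFDerivAt (fun z => randersNorm a β z ^ 2)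
      ((2 * randersNorm a β y) • ((√(a y y))⁻¹ • LinearMap.toContinuousLinearMap (a y) +
        LinearMap.toContinuousLinearMap β)) y := by
  have h := ((hasFDerivAt_sqrt_bilin ha hy).add
    (LinearMap.toContinuousLinearMap β).hasFDerivAt).pow 2
  refine h.congr_fderiv ?_
  ext v
  simp [randersNorm]
  ring

theorem fderiv_fderiv_randersNorm_sq (ha : ∀ v w, a v w = a w v)
    (hpos : ∀ v, v ≠ 0 → 0 < a v v) (hy : y ≠ 0) (v w : E) :
    fderiv ℝ (fun z => fderiv ℝ (fun z' => randersNorm a β z' ^ 2) z w) y v =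
      2 * randersForm a β y v w := by
  have hyy := hpos y hy
  have hs : √(a y y) ≠ 0 := (Real.sqrt_pos.2 hyy).ne'
  have hev : (fun z => fderiv ℝ (fun z' => randersNorm a β z' ^ 2) z w) =ᶠ[nhds y]
      fun z => 2 * (√(a z z) + β z) * ((√(a z z))⁻¹ * a z w + β w) := by
    filter_upwards [isOpen_ne.mem_nhds hy] with z hz
    rw [(hasFDerivAt_randersNorm_sq ha (hpos z hz)).fderiv]
    simp [randersNorm]
    ring
  rw [hev.fderiv_eq]
  have h1 := hasFDerivAt_sqrt_bilin ha hyy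
  have hinv := (hasDerivAt_inv hs).comp_hasFDerivAt y h1
  have hw : HasFDerivAt (fun z => a z w) (LinearMap.toContinuousLinearMap (a.flip w)) y :=
    (LinearMap.toContinuousLinearMap (a.flip w)).hasFDerivAt
  have h := ((h1.add (LinearMap.toContinuousLinearMap β).hasFDerivAt).const_mul 2).mul
    ((hinv.mul hw).add_const (β w))
  have e := h.fderiv
  refine (DFunLike.congr_fun e v).trans ?_
  have hsq : √(a y y) ^ 2 = a y y := Real.sq_sqrt hyy.le
  simp [randersForm_apply, randersNorm]
  field_simp
  ring

end RandersNormDeriv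

/-! ### Curvature in local coordinates -/

namespace Finsler

open Matrix

variable {n : ℕ} {L : Coord n → Coord n → ℝ} {u y : Coord n}

/-- If the Chern connection does not depend on the direction near `u`, then its curvature at `u`
does not either. -/
theorem chernCurvature_eq_of_chern_eq {s : Set (Coord n)} (hs : IsOpen s) (hu : u ∈ s)
    (h : ∀ u ∈ s, ∀ y z : Coord n, y ≠ 0 → z ≠ 0 → ∀ i j k,
      chern L i j k u y = chern L i j k u z)
    {z : Coord n} (hy : y ≠ 0) (hz : z ≠ 0) (j i k l : Fin n) :
    chernCurvature L j i k l u y = chernCurvature L j i k l u z := by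
  have hδ : ∀ {y : Coord n}, y ≠ 0 → ∀ i j l k,
      horizDeriv L (chern L i j l) k u y = pdx (chern L i j l) k u y := by
    intro y hy i j l k
    have h0 : ∀ m, pdy (chern L i j l) m u y = 0 := fun m => by
      have hev : (fun y' => chern L i j l u y') =ᶠ[nhds y] fun _ => chern L i j l u y := by
        filter_upwards [isOpen_ne.mem_nhds hy] with y' hy'
        exact h u hu _ _ hy' hy i j l
      rw [pdy, hev.fderiv_eq]
      simp
    simp [horizDeriv, h0]
  have hx : ∀ i j l k, pdx (chern L i j l) k u y = pdx (chern L i j l) k u z := by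
    intro i j l k
    have hev : (fun u' => chern L i j l u' y) =ᶠ[nhds u] fun u' => chern L i j l u' z := by
      filter_upwards [hs.mem_nhds hu] with u' hu'
      exact h u' hu' _ _ hy hz i j l
    rw [pdx, pdx, hev.fderiv_eq]
  simp only [chernCurvature, hδ hy, hδ hz, hx, h u hu y z hy hz]

theorem chernCurvature_antisymm (j i k l : Fin n) :
    chernCurvature L j i k l u y = -chernCurvature L j i l k u y := by
  simp only [chernCurvature, Finset.sum_sub_distrib]
  ring

/-- The matrix `yʲ R_jⁱ_kl yˡ` of the linear map `v ↦ R(v, y) y`. -/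
noncomputable def flagMatrix (L : Coord n → Coord n → ℝ) (u y : Coord n) : Matrix (Fin n) (Fin n) ℝ :=
  Matrix.of fun i k => ∑ j, ∑ l, y j * chernCurvature L j i k l u y * y l

theorem curvatureVec_eq_flagMatrix_mulVec (v : Coord n) :
    (curvatureVec L u y v).ofLp = flagMatrix L u y *ᵥ v.ofLp := by
  ext i
  simp only [curvatureVec, flagMatrix, mulVec, dotProduct, Matrix.of_apply, Finset.sum_mul]
  rw [Finset.sum_comm]
  refine Finset.sum_congr rfl fun k _ => Finset.sum_congr rfl fun j _ =>
    Finset.sum_congr rfl fun l _ => ?_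
  ring

theorem flagMatrix_mulVec_self : flagMatrix L u y *ᵥ y.ofLp = 0 := by
  rw [← curvatureVec_eq_flagMatrix_mulVec]
  ext i
  simp only [curvatureVec, Pi.zero_apply]
  refine Finset.sum_eq_zero fun j _ => ?_
  have h : ∑ k, ∑ l, y j * chernCurvature L j i k l u y * y k * y l =
      -∑ k, ∑ l, y j * chernCurvature L j i k l u y * y k * y l := by
    conv_lhs => rw [Finset.sum_comm]
    simp only [← Finset.sum_neg_distrib]
    refine Finset.sum_congr rfl fun k _ => Finset.sum_congr rfl fun l _ => ?_
    rw [chernCurvature_antisymm]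
    ring
  linarith

/-- Where the curvature is the same in the directions `y` and `-y`, so is the Ricci curvature
`yʲ R_jⁱ_il yˡ`. -/
theorem trace_flagMatrix_neg
    (h : ∀ j i k l, chernCurvature L j i k l u (-y) = chernCurvature L j i k l u y) :
    (flagMatrix L u (-y)).trace = (flagMatrix L u y).trace := by
  simp [trace, flagMatrix, h]

theorem fundInner_eq_dotProduct (v w : Coord n) :
    fundInner L u y v w =
      v.ofLp ⬝ᵥ (Matrix.of fun i j => fundTensor L i j u y) *ᵥ w.ofLp := by
  simp only [fundInner, mulVec, dotProduct, Matrix.of_apply, Finset.mul_sum]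
  refine Finset.sum_congr rfl fun i _ => Finset.sum_congr rfl fun j _ => ?_
  ring

section Randers

variable {a : LinearMap.BilinForm ℝ (Coord n)} {β : Coord n →ₗ[ℝ] ℝ}

theorem fundTensor_eq_randersForm (hL : ∀ y, L u y = randersNorm a β y)
    (ha : ∀ v w, a v w = a w v) (hpos : ∀ v, v ≠ 0 → 0 < a v v) (hy : y ≠ 0) (i j : Fin n) :
    fundTensor L i j u y = randersForm a β y (coordVec i) (coordVec j) := by
  have := fderiv_fderiv_randersNorm_sq (β := β) ha hpos hy (coordVec i) (coordVec j)
  simp only [fundTensor, pdy, hL, this]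
  ring

theorem fundInner_eq_randersForm (hL : ∀ y, L u y = randersNorm a β y)
    (ha : ∀ v w, a v w = a w v) (hpos : ∀ v, v ≠ 0 → 0 < a v v) (hy : y ≠ 0) (v w : Coord n) :
    fundInner L u y v w = randersForm a β y v w := by
  have hsum : ∀ v : Coord n, v = ∑ i, v i • coordVec i := fun v => by
    simpa using ((EuclideanSpace.basisFun (Fin n) ℝ).sum_repr v).symm
  conv_rhs => rw [hsum v, hsum w]
  simp only [fundInner, fundTensor_eq_randersForm hL ha hpos hy, map_sum, map_smul,
    LinearMap.sum_apply, LinearMap.smul_apply, smul_eq_mul, Finset.mul_sum]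
  rw [Finset.sum_comm]
  refine Finset.sum_congr rfl fun i _ => Finset.sum_congr rfl fun j _ => ?_
  ring

/-- If all flags with flagpole `y` have flag curvature `K`, then the Ricci curvature in the
direction `y` is `K (n - 1) F(y)²`. -/
theorem trace_flagMatrix_of_localFlagCurvature_eq (hL : ∀ y, L u y = randersNorm a β y)
    (ha : ∀ v w, a v w = a w v) (hpos : ∀ v, v ≠ 0 → 0 < a v v) (hy : y ≠ 0)
    (hF : 0 < randersNorm a β y) {K : ℝ}
    (hK : ∀ v, LinearIndependent ℝ ![y, v] → localFlagCurvature L u y v = K) :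
    (flagMatrix L u y).trace = K * (n - 1) * randersNorm a β y ^ 2 := by
  have hin := fundInner_eq_randersForm hL ha hpos hy
  have hGpos : ∀ v, v ≠ 0 → 0 < randersForm a β y v v := fun v hv =>
    randersForm_pos ha hpos hy hF hv
  set G : Matrix (Fin n) (Fin n) ℝ := Matrix.of fun i j => fundTensor L i j u y with hG
  have hGd : ∀ v w : Coord n, v.ofLp ⬝ᵥ G *ᵥ w.ofLp = randersForm a β y v w := fun v w => by
    rw [← hin, fundInner_eq_dotProduct]
  have hsymm : G.IsSymm := by
    ext i j
    simp only [hG, Matrix.transpose_apply, Matrix.of_apply,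
      fundTensor_eq_randersForm hL ha hpos hy]
    exact randersForm_comm ha _ _
  have hdet : IsUnit G.det := by
    rw [isUnit_iff_ne_zero, Ne, ← Matrix.exists_mulVec_eq_zero_iff]
    rintro ⟨v, hv, hv0⟩
    have h1 := hGpos (WithLp.toLp 2 v) (fun h => hv (by simpa using congrArg WithLp.ofLp h))
    rw [← hGd] at h1
    simp [hv0] at h1
  have key := trace_eq_of_dotProduct_mulVec_eq (T := flagMatrix L u y) (K := K) (y := y.ofLp)
    hsymm hdet (fun v' => by
      obtain ⟨v, rfl⟩ : ∃ v : Coord n, v.ofLp = v' := ⟨WithLp.toLp 2 v', rfl⟩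
      rw [← mulVec_mulVec]
      by_cases hli : LinearIndependent ℝ ![y, v]
      · have hcs := (LinearMap.BilinForm.apply_sq_lt_iff_linearIndependent_of_symm _ hGpos
          ⟨fun x z => randersForm_comm ha x z⟩ y v).2 hli
        have h := hK v hli
        rw [localFlagCurvature, hin, hin, hin, hin, div_eq_iff (sub_pos.2 hcs).ne'] at h
        rw [← curvatureVec_eq_flagMatrix_mulVec, hGd, hGd, hGd, hGd, randersForm_comm ha, h]
      · obtain ⟨c, rfl⟩ : ∃ c : ℝ, v = c • y := by
          rw [LinearIndependent.pair_iff' hy] at hli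
          push Not at hli
          exact hli.imp fun c hc => hc.symm
        simp only [WithLp.ofLp_smul, mulVec_smul, flagMatrix_mulVec_self, smul_dotProduct,
          dotProduct_smul, mulVec_zero, dotProduct_zero, smul_eq_mul]
        ring)
  rw [key, hGd, randersForm_self (hpos y hy), Fintype.card_fin]

/-- A Randers norm whose Chern connection is independent of the direction near `u` and whose flag
curvature at `u` is a nonzero constant has no linear part at `u`: the Ricci curvature is even
in `y` and proportional to `F²`. -/
theorem eq_zero_of_localFlagCurvature_eq (hn : 2 ≤ n) (hL : ∀ y, L u y = randersNorm a β y)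
    (ha : ∀ v w, a v w = a w v) (hpos : ∀ v, v ≠ 0 → 0 < a v v)
    (hF : ∀ y, y ≠ 0 → 0 < randersNorm a β y)
    {s : Set (Coord n)} (hs : IsOpen s) (hu : u ∈ s)
    (hB : ∀ u ∈ s, ∀ y z : Coord n, y ≠ 0 → z ≠ 0 → ∀ i j k,
      chern L i j k u y = chern L i j k u z)
    {K : ℝ} (hK0 : K ≠ 0)
    (hK : ∀ y v, LinearIndependent ℝ ![y, v] → localFlagCurvature L u y v = K) :
    β = 0 := by
  ext y
  rcases eq_or_ne y 0 with rfl | hy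
  · simp
  have hy' := neg_ne_zero.2 hy
  have h := trace_flagMatrix_neg fun j i k l =>
    chernCurvature_eq_of_chern_eq hs hu hB hy' hy j i k l
  rw [trace_flagMatrix_of_localFlagCurvature_eq hL ha hpos hy' (hF _ hy') (hK _),
    trace_flagMatrix_of_localFlagCurvature_eq hL ha hpos hy (hF _ hy) (hK _)] at h
  have hn' : (n : ℝ) - 1 ≠ 0 := by
    have : (2 : ℝ) ≤ n := by exact_mod_cast hn
    linarith
  exact eq_zero_of_randersNorm_sq_neg (hpos y hy)
    (mul_left_cancel₀ (mul_ne_zero hK0 hn') h)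

end Randers

end Finsler

/-! ### Randers metrics in a chart -/

section ChartVec

variable {n : ℕ} {M : Type*} [TopologicalSpace M] [ChartedSpace (Coord n) M]

theorem chartVec_add (φ : OpenPartialHomeomorph M (Coord n)) (u y z : Coord n) :
    chartVec φ u (y + z) = chartVec φ u y + chartVec φ u z :=
  map_add (mfderiv (𝓡 n) (𝓡 n) φ.symm u) y z

theorem chartVec_smul (φ : OpenPartialHomeomorph M (Coord n)) (u : Coord n) (c : ℝ)
    (y : Coord n) : chartVec φ u (c • y) = c • chartVec φ u y :=
  map_smul (mfderiv (𝓡 n) (𝓡 n) φ.symm u) c y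

end ChartVec

namespace RandersMetric

variable {n : ℕ} {M : Type*} [TopologicalSpace M] [ChartedSpace (Coord n) M]
  [IsManifold (𝓡 n) ∞ M]

/-- The bilinear form `g` at the point with coordinates `u` in the chart `φ`, read on the
components of tangent vectors. -/
noncomputable def chartForm (R : RandersMetric n M) (φ : OpenPartialHomeomorph M (Coord n)) (u : Coord n) :
    LinearMap.BilinForm ℝ (Coord n) :=
  LinearMap.mk₂ ℝ (fun y z => R.g.inner (φ.symm u) (chartVec φ u y) (chartVec φ u z))
    (fun y y' z => by simp [chartVec_add]) (fun c y z => by simp [chartVec_smul])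
    (fun y z z' => by simp [chartVec_add]) (fun c y z => by simp [chartVec_smul])

/-- The linear form `b` at the point with coordinates `u` in the chart `φ`, read on the
components of tangent vectors. -/
noncomputable def chartDrift (R : RandersMetric n M) (φ : OpenPartialHomeomorph M (Coord n)) (u : Coord n) :
    Coord n →ₗ[ℝ] ℝ where
  toFun y := R.b (φ.symm u) (chartVec φ u y)
  map_add' y z := by simp [chartVec_add]
  map_smul' c y := by simp [chartVec_smul]

variable (R : RandersMetric n M) {φ : OpenPartialHomeomorph M (Coord n)} {u : Coord n}

theorem localExpr_eq_randersNorm (y : Coord n) :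
    localExpr R.F φ u y = randersNorm (R.chartForm φ u) (R.chartDrift φ u) y :=
  rfl

theorem chartForm_comm (v w : Coord n) : R.chartForm φ u v w = R.chartForm φ u w v :=
  R.g.symm _ _ _

theorem chartForm_pos (x : M) (hu : u ∈ (chartAt (Coord n) x).target) {v : Coord n}
    (hv : v ≠ 0) : 0 < R.chartForm (chartAt (Coord n) x) u v v := by
  refine R.g.pos _ _ fun h => hv ?_
  have : IsManifold (𝓡 n) 1 M := .of_le (n := ∞) (by norm_num)
  have he := (mdifferentiable_chart (I := 𝓡 n) (H := Coord n) x).symm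
  exact he.mfderiv_injective (by exact hu) (h.trans (map_zero _).symm)

theorem b_eq_zero_of_chartDrift_eq_zero (x : M)
    (h : R.chartDrift (chartAt (Coord n) x) (chartAt (Coord n) x x) = 0) : R.b x = 0 := by
  have : IsManifold (𝓡 n) 1 M := .of_le (n := ∞) (by norm_num)
  set φ := chartAt (Coord n) x
  have hx : φ.symm (φ x) = x := φ.left_inv (mem_chart_source _ x)
  have he := (mdifferentiable_chart (I := 𝓡 n) (H := Coord n) x).symm
  have hb : R.b (φ.symm (φ x)) = 0 := by
    ext v
    obtain ⟨y, rfl⟩ := he.mfderiv_surjective (mem_chart_target _ x) v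
    exact DFunLike.congr_fun h y
  rw [hx] at hb
  exact hb

/-- The bound `‖b‖ < 1` says that the `g`-dual vector of `b` has length less than one. -/
theorem exists_dual_chartDrift (x : M) :
    ∃ w : Coord n,
      (∀ v, R.chartDrift (chartAt (Coord n) x) (chartAt (Coord n) x x) v =
        R.chartForm (chartAt (Coord n) x) (chartAt (Coord n) x x) w v) ∧
      R.chartForm (chartAt (Coord n) x) (chartAt (Coord n) x x) w w < 1 := by
  set φ := chartAt (Coord n) x
  set a := R.chartForm φ (φ x) with ha
  set β := R.chartDrift φ (φ x) with hβ
  have hsum : ∀ v : Coord n, v = ∑ i, v i • coordVec i := fun v => by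
    simpa using ((EuclideanSpace.basisFun (Fin n) ℝ).sum_repr v).symm
  set A : Matrix (Fin n) (Fin n) ℝ :=
    Matrix.of fun i j => RiemMetric.comp R.g φ i j (φ x) with hA
  set c : Fin n → ℝ := fun i => formComp R.b φ i (φ x) with hc
  have hAij : ∀ i j, A i j = a (coordVec i) (coordVec j) := fun i j => rfl
  have hci : ∀ i, c i = β (coordVec i) := fun i => rfl
  have hAv : ∀ (v : Coord n) (i : Fin n), (A.mulVec v.ofLp) i = a v (coordVec i) := by
    intro v i
    conv_rhs => rw [R.chartForm_comm, hsum v]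
    simp only [Matrix.mulVec, dotProduct, hAij, map_sum, map_smul, smul_eq_mul]
    exact Finset.sum_congr rfl fun j _ => mul_comm _ _
  have hdet : IsUnit A.det := by
    rw [isUnit_iff_ne_zero, Ne, ← Matrix.exists_mulVec_eq_zero_iff]
    rintro ⟨v, hv, hv0⟩
    have h1 := R.chartForm_pos x (mem_chart_target _ x) (v := WithLp.toLp 2 v)
      (fun h => hv (by simpa using congrArg WithLp.ofLp h))
    have h2 : a (WithLp.toLp 2 v) (WithLp.toLp 2 v) = 0 := by
      nth_rewrite 2 [hsum (WithLp.toLp 2 v)]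
      simp only [map_sum, map_smul, ← hAv, hv0]
      simp
    exact h1.ne' h2
  set w : Coord n := WithLp.toLp 2 (A⁻¹.mulVec c) with hw
  have hdual : ∀ v, β v = a w v := by
    intro v
    have hb : ∀ i, a w (coordVec i) = β (coordVec i) := fun i => by
      rw [← hAv, ← hci, hw]
      simp [Matrix.mulVec_mulVec, Matrix.mul_nonsing_inv _ hdet]
    rw [hsum v]
    simp only [map_sum, map_smul, hb]
  refine ⟨w, hdual, ?_⟩
  have hnorm := R.norm_lt_one x
  rw [← hdual]
  refine lt_of_eq_of_lt ?_ hnorm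
  rw [hsum w]
  simp only [map_sum, map_smul, smul_eq_mul, formNormSq]
  refine Finset.sum_congr rfl fun i _ => ?_
  change (∑ j, A⁻¹ i j * c j) * c i = ∑ j, A⁻¹ i j * c i * c j
  rw [Finset.sum_mul]
  exact Finset.sum_congr rfl fun j _ => by ring

theorem randersNorm_chart_pos (x : M) {y : Coord n} (hy : y ≠ 0) :
    0 < randersNorm (R.chartForm (chartAt (Coord n) x) (chartAt (Coord n) x x))
      (R.chartDrift (chartAt (Coord n) x) (chartAt (Coord n) x x)) y := by
  obtain ⟨w, hw, hw1⟩ := R.exists_dual_chartDrift x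
  exact randersNorm_pos R.chartForm_comm
    (fun _ hv => R.chartForm_pos x (mem_chart_target _ x) hv) hw hw1 hy

/-- A constant flag curvature is seen by all pairs of component vectors in the preferred
chart. -/
theorem localFlagCurvature_eq_of_hasConstantFlagCurvature {K : ℝ}
    (hK : HasConstantFlagCurvature R.F K) (x : M) {y v : Coord n}
    (h : LinearIndependent ℝ ![y, v]) :
    Finsler.localFlagCurvature (localExpr R.F (chartAt (Coord n) x)) (chartAt (Coord n) x x)
      y v = K := by
  have : IsManifold (𝓡 n) 1 M := .of_le (n := ∞) (by norm_num)
  have he := mdifferentiable_chart (I := 𝓡 n) (H := Coord n) x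
  obtain ⟨Y, hY⟩ := he.mfderiv_surjective (mem_chart_source _ x) y
  obtain ⟨V, hV⟩ := he.mfderiv_surjective (mem_chart_source _ x) v
  have hli : LinearIndependent ℝ ![Y, V] := by
    rw [LinearIndependent.pair_iff] at h ⊢
    intro s t hst
    refine h s t ?_
    have := congrArg (mfderiv (𝓡 n) (𝓡 n) (chartAt (Coord n) x) x) hst
    rw [map_add, map_smul, map_smul, hY, hV, map_zero] at this
    exact this
  have := hK x Y V hli
  rw [flagCurvature] at this
  rw [← this]
  exact congrArg₂ _ hY.symm hV.symm

theorem isRiemannian_of_drift_eq_zero (h : ∀ x, R.b x = 0) : IsRiemannian R.F :=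
  ⟨R.g, fun x y => by simp [F, h x]⟩

end RandersMetric

/-! ### Randers metrics of Berwald type and constant flag curvature -/

theorem corollary1 {n : ℕ} (hn : 2 ≤ n) {M : Type*} [TopologicalSpace M]
    [ChartedSpace (Coord n) M] [IsManifold (𝓡 n) ∞ M] :
    ¬ ∃ R : RandersMetric n M,
      ¬ IsRiemannian R.F ∧ IsBerwald R.F ∧
      (∀ (x : M) (v : TangentSpace (𝓡 n) x), R.beta x v = 0) ∧
      ∃ K : ℝ, 0 < K ∧ HasConstantFlagCurvature R.F K := by
  rintro ⟨R, hR, hB, -, K, hK0, hK⟩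
  refine hR (R.isRiemannian_of_drift_eq_zero fun x => R.b_eq_zero_of_chartDrift_eq_zero x ?_)
  exact Finsler.eq_zero_of_localFlagCurvature_eq hn R.localExpr_eq_randersNorm R.chartForm_comm
    (fun _ hv => R.chartForm_pos x (mem_chart_target _ x) hv)
    (fun _ hy => R.randersNorm_chart_pos x hy)
    (chartAt (Coord n) x).open_target (mem_chart_target _ x)
    (hB _ (IsManifold.chart_mem_maximalAtlas x)) hK0.ne'
    (fun _ _ h => R.localFlagCurvature_eq_of_hasConstantFlagCurvature hK x h)
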